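/- Let $k \ge 1$ and let $G=(V,E)$ be an arbitrary finite simple undirected graph with $n = |V| \ge 1$ vertices. In the $k$-strategy network coordination game on $G$, the vertices are the players, a strategy profile is $\sigma \in [k]^V$, every edge $uv \in E$ carries a $k \times k$ payoff matrix $A_{uv}$ (with $A_{uv}(i,j) = A_{vu}(j,i)$), and player $u$ receives $$\mathrm{payoff}_u(\sigma) = \sum_{v :\, uv \in E} A_{uv}(\sigma_u,\sigma_v).$$ Non-edges contribute nothing and are not perturbed. A profile is a pure Nash equilibrium if no player can strictly increase her own payoff by unilaterally changing her strategy. An execution of better-response dynamics starts at an arbitrary profile; as long as the current profile is not a pure Nash equilibrium, one player changes to a strategy that strictly increases her own payoff (the player and the strategy being chosen arbitrarily, possibly adversarially and with knowledge of all payoffs), and it stops at a pure Nash equilibrium. Suppose the $|E|k^2$ payoff entries are independent real random variables supported on $[-1,1]$, each with a probability density bounded by $\phi$. Then the number of steps is at most $\phi\cdot(nk)^{O(k\log(nk))}$ with probability $1 - 1/\mathrm{poly}(n,k)$. Precisely: for every $c > 0$ there is a constant $C > 0$, depending only on $c$, such that for all such $k$, $G$, $\phi$ and payoff distributions, with probability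 at least $1 - (nk)^{-c}$ over the draw of the payoffs, every execution of better-response dynamics, from every initial strategy profile, reaches a pure Nash equilibrium after at most $$\phi \cdot (nk)^{\,C k \ln(nk)}$$ steps. -/

import Mathlib

open MeasureTheory ProbabilityTheory
open scoped NNReal ENNReal

namespace NetCoord

/-- Index set of the payoff vector of a `k`-strategy network coordination game on `G`: unordered
pairs `{(u, i), (v, j)}` of (player, strategy) pairs such that `uv` is an edge of `G`.
There are `|E| * k ^ 2` of them, and both players of an edge read the same entry. -/
abbrev PayoffIndex {V : Type*} (G : SimpleGraph V) (k : ℕ) : Type _ :=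
  {p : Sym2 (V × Fin k) // p.map Prod.fst ∈ G.edgeSet}

/-- The index of the entry `A_{uv}(i, j)`. -/
def entry {V : Type*} {G : SimpleGraph V} {k : ℕ} {u v : V} (h : G.Adj u v) (i j : Fin k) :
    PayoffIndex G k :=
  ⟨s((u, i), (v, j)), h⟩

section Game

variable {V : Type*} [Fintype V] [DecidableEq V] {G : SimpleGraph V} [DecidableRel G.Adj] {k : ℕ}

/-- Payoff of player `u`: the sum of `A_{uv}(σ_u, σ_v)` over the neighbours `v` of `u`. -/
def payoff (A : PayoffIndex G k → ℝ) (σ : V → Fin k) (u : V) : ℝ :=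
  ∑ v : G.neighborSet u, A (entry v.2 (σ u) (σ v))

/-- No player gains by deviating unilaterally. -/
def IsPureNash (A : PayoffIndex G k → ℝ) (σ : V → Fin k) : Prop :=
  ∀ (u : V) (i : Fin k), payoff A (Function.update σ u i) u ≤ payoff A σ u

/-- `σ'` arises from `σ` by one better-response move: a single player changes strategy
and strictly improves her own payoff. -/
def IsBetterResponse (A : PayoffIndex G k → ℝ) (σ σ' : V → Fin k) : Prop :=
  ∃ (u : V) (i : Fin k), σ' = Function.update σ u i ∧ payoff A σ u < payoff A σ' u

/-- An execution of better-response dynamics: `σ t` is the profile after `t` steps. As long as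
the current profile is not a pure Nash equilibrium, some better-response move is made, chosen
arbitrarily; at a pure Nash equilibrium the dynamics stops. -/
def IsExecution (A : PayoffIndex G k → ℝ) (σ : ℕ → V → Fin k) : Prop :=
  ∀ t, (¬ IsPureNash A (σ t) → IsBetterResponse A (σ t) (σ (t + 1))) ∧
    (IsPureNash A (σ t) → σ (t + 1) = σ t)

end Game

/-- The payoff entries are independent real random variables, supported on `[-1, 1]`, each with a
probability density with respect to Lebesgue measure that is at most `φ`. -/
structure IsSmoothed {V Ω : Type*} [MeasurableSpace Ω] {G : SimpleGraph V} {k : ℕ}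
    (μ : Measure Ω) (A : PayoffIndex G k → Ω → ℝ) (φ : ℝ≥0) : Prop where
  indep : iIndepFun A μ
  hasPDF : ∀ e, HasPDF (A e) μ volume
  pdf_le : ∀ e, ∀ᵐ x ∂(volume : Measure ℝ), pdf (A e) μ volume x ≤ φ
  mem_Icc : ∀ e, ∀ᵐ ω ∂μ, A e ω ∈ Set.Icc (-1 : ℝ) 1

end NetCoord

/-!
The sum of the payoff entries over all edges is a potential: a move changes it by as much as the
payoff of the mover (`NetCoord.potential_sub_potential`), and it stays within an interval of length
`n ^ 2`. So it suffices that, outside an event of small probability, every window of `O(n k)`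
consecutive moves increases the potential by at least some `ε`, where `1 / ε` is `φ` times
`(n k) ^ O(k log (n k))`.

*Cycles.* A player that moves at least `k` times returns to an earlier strategy. Her total
improvement along such a cycle is positive, and it is a linear form with integer coefficients in the
payoff entries that involves only edges to players moving in the same block, since the contributions
of all others telescope (`NetCoord.sum_payoff_sub_eq_sum_cycleCoeff`). Each form is nonzero and is
supported on the edges at its player, so an entry of an edge occurs in at most two forms; hence half
of the forms are triangular with respect to suitable entries, and the probability that all of them
lie in `(0, ε)` is at most `φ ε` to the power of half the number of players with a cycle
(`NetCoord.pi_slowBlock_le`).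

*Blocks.* A window of `2 ^ m ≥ 2 n k` moves contains a dyadic block of some length `ℓ` in which at
least `ℓ / (2 k (m + 1))` players move `k` times or more (`NetCoord.exists_dyadic_block`). If not,
summing over the blocks of each level would leave too few frequent pairs of a player and a block,
whereas a player with `h` frequent blocks moves at most `(k - 1) (h + 1)` times in the window.

*Union bound.* The forms of a block of length `ℓ` depend only on its moves and on the initial
strategies of the players that move, for which there are at most `(n k ^ 2) ^ ℓ` possibilities. Since
the exponent of `φ ε` is at least `ℓ / (4 k (m + 1))` and `m = O(log (n k))`, the choice
`φ ε = (n k) ^ (-O(k log (n k)))` makes the sum of all these probabilities small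
(`NetCoord.pi_exists_slowBlock_le`).
-/

namespace NetCoord

/-! ### Dyadic blocks with many frequent players -/

section Dyadic

variable {V : Type*} [DecidableEq V]

/-- The number of times `t < ℓ` at which the player `u t` is `v`. -/
def visits (u : ℕ → V) (ℓ : ℕ) (v : V) : ℕ :=
  ∑ t ∈ Finset.range ℓ, if u t = v then 1 else 0

theorem visits_add (u : ℕ → V) (ℓ ℓ' : ℕ) (v : V) :
    visits u (ℓ + ℓ') v = visits u ℓ v + visits (fun t => u (ℓ + t)) ℓ' v :=
  Finset.sum_range_add _ _ _

variable [Fintype V]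

theorem sum_visits (u : ℕ → V) (ℓ : ℕ) : ∑ v, visits u ℓ v = ℓ := by
  unfold visits
  rw [Finset.sum_comm]
  simp

/-- The players that move at least `k` times among the first `ℓ` moves. -/
def frequent (u : ℕ → V) (k ℓ : ℕ) : Finset V :=
  Finset.univ.filter fun v => k ≤ visits u ℓ v

/-- The weight `H v` counts the dyadic blocks in which `v` is frequent. Halving a block splits the
visits of `v`, so a player with few frequent blocks has few visits; the sum of the weights is
controlled level by level. -/
theorem exists_weight (K k : ℕ) (hk : 1 ≤ k) (m : ℕ) : ∀ u : ℕ → V,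
    (∀ a j, a + 2 ^ j ≤ 2 ^ m → K * (frequent (fun t => u (a + t)) (k + 1) (2 ^ j)).card ≤ 2 ^ j) →
    ∃ H : V → ℕ, (∀ v, visits u (2 ^ m) v ≤ k * (1 + H v)) ∧ K * ∑ v, H v ≤ (m + 1) * 2 ^ m := by
  induction m with
  | zero =>
    intro u _
    refine ⟨fun _ => 0, fun v => ?_, by simp⟩
    simp only [visits, pow_zero, Finset.range_one, Finset.sum_singleton]
    split_ifs <;> omega
  | succ m ih =>
    intro u hu
    have hpow : 2 ^ (m + 1) = 2 ^ m + 2 ^ m := by ring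
    have hpos : 0 < 2 ^ m := by positivity
    obtain ⟨H₁, h₁, s₁⟩ := ih u fun a j h => hu a j (by omega)
    obtain ⟨H₂, h₂, s₂⟩ := ih (fun t => u (2 ^ m + t)) fun a j h => by
      simpa only [add_assoc] using hu (2 ^ m + a) j (by omega)
    have h₀ := hu 0 (m + 1) (by omega)
    simp only [zero_add] at h₀
    refine ⟨fun v => (if k + 1 ≤ visits u (2 ^ (m + 1)) v then 1 else 0) + (H₁ v + H₂ v),
      fun v => ?_, ?_⟩
    · have hv := visits_add u (2 ^ m) (2 ^ m) v
      rw [← hpow] at hv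
      have := h₁ v
      have := h₂ v
      dsimp only
      split_ifs with hc
      · nlinarith
      · nlinarith [Nat.zero_le (k * (H₁ v + H₂ v))]
    · have hcard : ∑ v, (if k + 1 ≤ visits u (2 ^ (m + 1)) v then 1 else 0) =
          (frequent u (k + 1) (2 ^ (m + 1))).card := by
        rw [frequent, Finset.card_filter]
      rw [Finset.sum_add_distrib, Finset.sum_add_distrib, hcard, mul_add, mul_add]
      rw [hpow] at h₀ ⊢
      nlinarith

theorem exists_dyadic_block (u : ℕ → V) {k m : ℕ} (hk : 2 ≤ k)
    (hm : 2 * (Fintype.card V * k) ≤ 2 ^ m) :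
    ∃ a j, a + 2 ^ j ≤ 2 ^ m ∧
      2 ^ j ≤ 2 * k * (m + 1) * (frequent (fun t => u (a + t)) k (2 ^ j)).card := by
  by_contra! hcon
  obtain ⟨k, rfl⟩ : ∃ k', k = k' + 1 := ⟨k - 1, by omega⟩
  obtain ⟨H, h, s⟩ := exists_weight (2 * (k + 1) * (m + 1)) k (by omega) m u
    fun a j haj => (hcon a j haj).le
  have hsum : 2 ^ m ≤ k * (Fintype.card V + ∑ v, H v) := by
    calc 2 ^ m = ∑ v, visits u (2 ^ m) v := (sum_visits u _).symm
      _ ≤ ∑ v, k * (1 + H v) := Finset.sum_le_sum fun v _ => h v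
      _ = _ := by rw [← Finset.mul_sum, Finset.sum_add_distrib]; simp
  have hs' : 2 * (k + 1) * ∑ v, H v ≤ 2 ^ m := by
    refine Nat.le_of_mul_le_mul_left ?_ (Nat.succ_pos m)
    calc (m + 1) * (2 * (k + 1) * ∑ v, H v) = 2 * (k + 1) * (m + 1) * ∑ v, H v := by ring
      _ ≤ _ := s
  have hpos : 0 < 2 ^ m := by positivity
  -- Multiplying `hsum` by `2 (k + 1)` and inserting `hm` and `hs'` gives `2 (k + 1) 2 ^ m ≤ 2 k 2 ^ m`.
  nlinarith [Nat.mul_le_mul_left k hm, Nat.mul_le_mul_left k hs',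
    Nat.mul_le_mul_left (2 * (k + 1)) hsum]

end Dyadic

section Cycles

variable {V : Type*} {G : SimpleGraph V} [DecidableRel G.Adj] {k : ℕ}

/-! ### The potential function -/

/-- The contribution of the pair `x v` to the payoff of `x`; it is zero if `x v` is not an edge. -/
def pairPayoff (A : PayoffIndex G k → ℝ) (σ : V → Fin k) (x v : V) : ℝ :=
  if h : G.Adj x v then A (entry h (σ x) (σ v)) else 0

theorem pairPayoff_comm (A : PayoffIndex G k → ℝ) (σ : V → Fin k) (x v : V) :
    pairPayoff A σ x v = pairPayoff A σ v x := by
  unfold pairPayoff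
  by_cases h : G.Adj x v
  · rw [dif_pos h, dif_pos h.symm]
    congr 1
    exact Subtype.ext Sym2.eq_swap
  · rw [dif_neg h, dif_neg fun h' => h h'.symm]

theorem pairPayoff_congr (A : PayoffIndex G k → ℝ) {σ τ : V → Fin k} {x v : V}
    (hx : σ x = τ x) (hv : σ v = τ v) : pairPayoff A σ x v = pairPayoff A τ x v := by
  unfold pairPayoff
  rw [hx, hv]

theorem pairPayoff_self (A : PayoffIndex G k → ℝ) (σ : V → Fin k) (x : V) :
    pairPayoff A σ x x = 0 := by
  simp [pairPayoff]

theorem exists_entry_of_pairPayoff_ne_zero [DecidableEq (PayoffIndex G k)] {e : PayoffIndex G k}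
    {σ : V → Fin k} {x v : V} (h : pairPayoff (Pi.single e 1) σ x v ≠ 0) :
    ∃ (hxv : G.Adj x v) (i j : Fin k), e = entry hxv i j := by
  unfold pairPayoff at h
  split_ifs at h with hxv
  · refine ⟨hxv, σ x, σ v, ?_⟩
    by_contra hne
    exact h (Pi.single_eq_of_ne (Ne.symm hne) _)
  · exact absurd rfl h

variable [Fintype V]

theorem payoff_eq_sum_pairPayoff (A : PayoffIndex G k → ℝ) (σ : V → Fin k) (x : V) :
    payoff A σ x = ∑ v, pairPayoff A σ x v := by
  unfold payoff pairPayoff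
  rw [Finset.sum_dite, Finset.sum_const_zero, add_zero]
  exact Finset.sum_bij' (fun v _ => ⟨v.1, Finset.mem_filter.2 ⟨Finset.mem_univ _, v.2⟩⟩)
    (fun v _ => ⟨v.1, (Finset.mem_filter.1 v.2).2⟩) (fun _ _ => Finset.mem_attach _ _)
    (fun _ _ => Finset.mem_univ _) (fun _ _ => rfl) (fun _ _ => rfl) (fun _ _ => rfl)

/-- Half the sum of all payoffs, that is, the sum of the payoff entries over all edges. -/
noncomputable def potential (A : PayoffIndex G k → ℝ) (σ : V → Fin k) : ℝ :=
  (∑ x, payoff A σ x) / 2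

theorem abs_potential_le {A : PayoffIndex G k → ℝ} (hA : ∀ e, A e ∈ Set.Icc (-1 : ℝ) 1)
    (σ : V → Fin k) : |potential A σ| ≤ (Fintype.card V : ℝ) ^ 2 / 2 := by
  have hpair : ∀ x v, |pairPayoff A σ x v| ≤ 1 := by
    intro x v
    unfold pairPayoff
    split_ifs with h
    · exact abs_le.2 (hA _)
    · simp
  have hpay : ∀ x, |payoff A σ x| ≤ Fintype.card V := fun x => by
    rw [payoff_eq_sum_pairPayoff]
    refine (Finset.abs_sum_le_sum_abs _ _).trans ((Finset.sum_le_sum fun v _ => hpair x v).trans ?_)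
    simp
  rw [potential, abs_div, abs_two]
  gcongr
  refine (Finset.abs_sum_le_sum_abs _ _).trans ((Finset.sum_le_sum fun v _ => hpay v).trans ?_)
  simp [sq]

variable [DecidableEq V]

/-- A change of strategy of a single player changes the potential as much as her own payoff. -/
theorem potential_sub_potential (A : PayoffIndex G k → ℝ) {σ σ' : V → Fin k} {x : V}
    (h : ∀ v, v ≠ x → σ' v = σ v) :
    potential A σ' - potential A σ = payoff A σ' x - payoff A σ x := by
  set D : V → V → ℝ := fun y z => pairPayoff A σ' y z - pairPayoff A σ y z with hD
  have hsymm : ∀ y z, D y z = D z y := fun y z => by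
    simp only [hD, pairPayoff_comm A _ y z]
  have hself : D x x = 0 := by simp [hD, pairPayoff_self]
  have hsplit : ∀ y z, D y z = (if y = x then D x z else 0) + if z = x then D x y else 0 := by
    intro y z
    split_ifs with hy hz hz
    · subst hy hz; simp [hself]
    · subst hy; simp
    · subst hz; simp [hsymm]
    · simp only [hD, add_zero, sub_eq_zero]
      exact pairPayoff_congr A (h y hy) (h z hz)
  have hsum : ∑ y, ∑ z, D y z = 2 * ∑ z, D x z := by
    rw [Finset.sum_congr rfl fun y _ => Finset.sum_congr rfl fun z _ => hsplit y z]
    simp_rw [Finset.sum_add_distrib]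
    rw [Finset.sum_comm, two_mul]
    simp
  simp only [potential, payoff_eq_sum_pairPayoff]
  rw [← sub_div, ← Finset.sum_sub_distrib, ← Finset.sum_sub_distrib]
  simp_rw [← Finset.sum_sub_distrib]
  change (∑ y, ∑ z, D y z) / 2 = ∑ z, D x z
  rw [hsum]
  ring

/-! ### Improvements along a cycle of strategies -/

noncomputable instance instFintypePayoffIndex : Fintype (PayoffIndex G k) := Fintype.ofFinite _

/-- Coefficients of the total improvement of player `x` in the time interval `[a, b)` as a linear
form in the payoff entries, keeping only the edges from `x` to players that move before
time `ℓ`. Here `σ t` is the profile after `t` moves and `u t` the player moving at time `t`. -/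
noncomputable def cycleCoeff (σ : ℕ → V → Fin k) (u : ℕ → V) (ℓ a b : ℕ) (x : V)
    (e : PayoffIndex G k) : ℝ :=
  open Classical in
  ∑ t ∈ Finset.Ico a b with u t = x, ∑ v with ∃ s < ℓ, u s = v,
    (pairPayoff (Pi.single e 1) (σ (t + 1)) x v - pairPayoff (Pi.single e 1) (σ t) x v)

theorem pairPayoff_eq_sum (A : PayoffIndex G k → ℝ) (σ : V → Fin k) (x v : V) :
    pairPayoff A σ x v = ∑ e, (open Classical in pairPayoff (Pi.single e 1) σ x v) * A e := by
  classical
  unfold pairPayoff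
  split_ifs with h
  · simp [Pi.single_apply]
  · simp

theorem exists_entry_of_cycleCoeff_ne_zero {σ : ℕ → V → Fin k} {u : ℕ → V} {ℓ a b : ℕ} {x : V}
    {e : PayoffIndex G k} (h : cycleCoeff σ u ℓ a b x e ≠ 0) :
    ∃ (v : V) (hxv : G.Adj x v) (i j : Fin k), e = entry hxv i j := by
  classical
  obtain ⟨t, -, ht⟩ := Finset.exists_ne_zero_of_sum_ne_zero h
  obtain ⟨v, -, hv⟩ := Finset.exists_ne_zero_of_sum_ne_zero ht
  refine ⟨v, ?_⟩
  by_cases h₁ : pairPayoff (Pi.single e 1) (σ (t + 1)) x v = 0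
  · rw [h₁, zero_sub, neg_ne_zero] at hv
    exact exists_entry_of_pairPayoff_ne_zero hv
  · exact exists_entry_of_pairPayoff_ne_zero h₁

/-- The coefficients are integers. -/
theorem one_le_abs_cycleCoeff {σ : ℕ → V → Fin k} {u : ℕ → V} {ℓ a b : ℕ} {x : V}
    {e : PayoffIndex G k} (h : cycleCoeff σ u ℓ a b x e ≠ 0) :
    1 ≤ |cycleCoeff σ u ℓ a b x e| := by
  classical
  have hpair : ∀ τ v, pairPayoff (Pi.single e 1) τ x v ∈ (Int.castAddHom ℝ).range := by
    intro τ v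
    unfold pairPayoff
    split_ifs with hxv
    · rw [Pi.single_apply]
      split_ifs
      · exact ⟨1, by simp⟩
      · exact zero_mem _
    · exact zero_mem _
  have hmem : cycleCoeff σ u ℓ a b x e ∈ (Int.castAddHom ℝ).range :=
    sum_mem fun t _ => sum_mem fun v _ => sub_mem (by convert hpair _ _) (by convert hpair _ _)
  obtain ⟨z, hz⟩ := hmem
  rw [← hz] at h ⊢
  simp only [Int.coe_castAddHom, ne_eq, Int.cast_eq_zero] at h ⊢
  exact_mod_cast Int.one_le_abs h

/-- While `x` moves from a strategy back to the same strategy, the contributions of the players that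
do not move telescope to zero. -/
theorem sum_payoff_sub_eq_sum_cycleCoeff (A : PayoffIndex G k → ℝ) {σ : ℕ → V → Fin k} {u : ℕ → V}
    {ℓ a b : ℕ} {x : V} (hstay : ∀ t < ℓ, ∀ v, v ≠ u t → σ (t + 1) v = σ t v)
    (hab : a ≤ b) (hb : b ≤ ℓ) (hcyc : σ a x = σ b x) :
    ∑ t ∈ Finset.Ico a b with u t = x, (payoff A (σ (t + 1)) x - payoff A (σ t) x) =
      ∑ e, cycleCoeff σ u ℓ a b x e * A e := by
  classical
  have hidle : ∀ v, (¬ ∃ s < ℓ, u s = v) → ∑ t ∈ Finset.Ico a b with u t = x,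
      (pairPayoff A (σ (t + 1)) x v - pairPayoff A (σ t) x v) = 0 := by
    intro v hv
    push Not at hv
    have hconst : ∀ t ≤ ℓ, σ t v = σ 0 v := by
      intro t
      induction t with
      | zero => simp
      | succ t ih => exact fun ht => (hstay t ht v (hv t ht).symm).trans (ih (by omega))
    have htel := Finset.sum_Ico_sub (fun t => pairPayoff A (σ t) x v) hab
    rw [pairPayoff_congr A hcyc.symm ((hconst b hb).trans (hconst a (by omega)).symm),
      sub_self] at htel
    rw [← htel]
    refine Finset.sum_filter_of_ne fun t ht hne => ?_
    by_contra hux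
    have htb := (Finset.mem_Ico.1 ht).2
    exact hne (sub_eq_zero.2 (pairPayoff_congr A (hstay t (by omega) x (Ne.symm hux))
      (hstay t (by omega) v (hv t (by omega)).symm)))
  have hpay : ∀ t, payoff A (σ (t + 1)) x - payoff A (σ t) x =
      ∑ v, (pairPayoff A (σ (t + 1)) x v - pairPayoff A (σ t) x v) := fun t => by
    rw [payoff_eq_sum_pairPayoff, payoff_eq_sum_pairPayoff, Finset.sum_sub_distrib]
  simp_rw [hpay]
  rw [Finset.sum_comm]
  rw [← Finset.sum_filter_of_ne (s := Finset.univ) (p := fun v => ∃ s < ℓ, u s = v)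
    (f := fun v => ∑ t ∈ Finset.Ico a b with u t = x,
      (pairPayoff A (σ (t + 1)) x v - pairPayoff A (σ t) x v))
    fun v _ hne => by_contra fun hv => hne (hidle v hv), Finset.sum_comm]
  simp only [cycleCoeff, Finset.sum_mul]
  refine Eq.trans (Finset.sum_congr rfl fun t _ => ?_) Finset.sum_comm
  refine Eq.trans (Finset.sum_congr rfl fun v _ => ?_) Finset.sum_comm
  rw [pairPayoff_eq_sum A (σ (t + 1)), pairPayoff_eq_sum A (σ t), ← Finset.sum_sub_distrib]
  exact Finset.sum_congr rfl fun e _ => (sub_mul _ _ _).symm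

/-- The coefficients depend only on the strategies of the players that move. -/
theorem cycleCoeff_congr {σ σ' : ℕ → V → Fin k} {u u' : ℕ → V} {ℓ a b : ℕ} {x : V} (hb : b ≤ ℓ)
    (hu : ∀ t < ℓ, u t = u' t) (hσ : ∀ t ≤ ℓ, ∀ s < ℓ, σ t (u s) = σ' t (u s)) :
    cycleCoeff (G := G) σ u ℓ a b x = cycleCoeff σ' u' ℓ a b x := by
  classical
  ext e
  unfold cycleCoeff
  refine Finset.sum_congr (Finset.filter_congr fun t ht => ?_) fun t ht => ?_
  · rw [hu t (by have := (Finset.mem_Ico.1 ht).2; omega)]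
  · obtain ⟨ht₁, ht₂⟩ := Finset.mem_filter.1 ht
    have htb := (Finset.mem_Ico.1 ht₁).2
    have htx : u t = x := by rw [hu t (by omega), ht₂]
    refine Finset.sum_congr (Finset.filter_congr fun v _ => ?_) fun v hv => ?_
    · exact exists_congr fun s => and_congr_right fun hs => by rw [hu s hs]
    · obtain ⟨s, hs, rfl⟩ := (Finset.mem_filter.1 hv).2
      rw [← hu s hs, ← htx, pairPayoff_congr _ (hσ (t + 1) (by omega) t (by omega))
        (hσ (t + 1) (by omega) s hs), pairPayoff_congr _ (hσ t (by omega) t (by omega))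
        (hσ t (by omega) s hs)]

/-- A player that moves at least `k` times returns to an earlier strategy. -/
theorem exists_cycle_of_mem_frequent (σ : ℕ → V → Fin k) {u : ℕ → V} {ℓ : ℕ} {x : V}
    (hx : x ∈ frequent u k ℓ) :
    ∃ a b t, a ≤ t ∧ t < b ∧ b ≤ ℓ ∧ u t = x ∧ σ a x = σ b x := by
  classical
  set S := (Finset.range ℓ).filter fun t => u t = x with hS
  have hcard : k ≤ S.card := by
    have := (Finset.mem_filter.1 hx).2
    rwa [visits, ← Finset.card_filter] at this
  set W := insert 0 (S.image Nat.succ) with hW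
  have hWcard : (Finset.univ : Finset (Fin k)).card < W.card := by
    rw [hW, Finset.card_insert_of_notMem (by simp),
      Finset.card_image_of_injective _ Nat.succ_injective, Finset.card_univ, Fintype.card_fin]
    omega
  have key : ∀ a ∈ W, ∀ b ∈ W, a < b → σ a x = σ b x →
      ∃ a b t, a ≤ t ∧ t < b ∧ b ≤ ℓ ∧ u t = x ∧ σ a x = σ b x := by
    intro a _ b hb hab hσ
    rcases Finset.mem_insert.1 hb with rfl | hb
    · omega
    · obtain ⟨t, ht, rfl⟩ := Finset.mem_image.1 hb
      obtain ⟨ht₁, ht₂⟩ := Finset.mem_filter.1 ht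
      have := Finset.mem_range.1 ht₁
      exact ⟨a, t.succ, t, by omega, by omega, by omega, ht₂, hσ⟩
  obtain ⟨a, ha, b, hb, hab, hσ⟩ := Finset.exists_ne_map_eq_of_card_lt_of_maps_to hWcard
    (f := fun t => σ t x) (fun t _ => Finset.mem_univ _)
  rcases lt_or_gt_of_ne hab with h | h
  · exact key a ha b hb h hσ
  · exact key b hb a ha h hσ.symm

end Cycles

/-! ### Small values of triangular systems of linear forms -/

theorem measure_affine_mem_Ioo_le {ν : Measure ℝ} {φ : ℝ≥0} (hν : ∀ s, ν s ≤ φ * volume s)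
    {c : ℝ} (hc : 1 ≤ |c|) (r ε : ℝ) :
    ν {t | c * t + r ∈ Set.Ioo 0 ε} ≤ φ * ENNReal.ofReal ε := by
  refine (hν _).trans (mul_le_mul_right ?_ _)
  have hset : {t | c * t + r ∈ Set.Ioo 0 ε} = (fun t => c * t) ⁻¹' Set.Ioo (-r) (ε - r) := by
    ext t
    simp only [Set.mem_ofPred_eq, Set.mem_preimage, Set.mem_Ioo]
    constructor <;> rintro ⟨h₁, h₂⟩ <;> constructor <;> linarith
  have hc₀ : c ≠ 0 := by
    rintro rfl
    norm_num at hc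
  rw [hset, Real.volume_preimage_mul_left hc₀, Real.volume_Ioo, abs_inv,
    ← ENNReal.ofReal_mul (by positivity)]
  by_cases hε : 0 ≤ ε
  · refine ENNReal.ofReal_le_ofReal ?_
    rw [show ε - r - -r = ε by ring]
    exact mul_le_of_le_one_left hε (inv_le_one_of_one_le₀ hc)
  · rw [ENNReal.ofReal_of_nonpos]
    · exact zero_le
    · rw [show ε - r - -r = ε by ring]
      exact mul_nonpos_of_nonneg_of_nonpos (by positivity) (not_le.1 hε).le

/-- Linear forms in independent variables of density at most `φ`, triangular with respect to the
variables `e x` and with diagonal entries at least `1` in absolute value: the probability that all of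
them lie in `(0, ε)` is at most `φ ε` to the number of forms. The variable `e y` with `f y` maximal
occurs in the form `y` only, and is integrated out first. -/
theorem pi_forall_mem_Ioo_le {ι V : Type*} [Fintype ι] {ν : ι → Measure ℝ}
    [∀ i, IsProbabilityMeasure (ν i)] {φ : ℝ≥0} (hν : ∀ i s, ν i s ≤ φ * volume s)
    (c : V → ι → ℝ) (e : V → ι) (f : V → ℤ) (ε : ℝ) (T : Finset V)
    (hdiag : ∀ x ∈ T, 1 ≤ |c x (e x)|)
    (htri : ∀ x ∈ T, ∀ y ∈ T, x ≠ y → f x ≤ f y → c x (e y) = 0) :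
    Measure.pi ν {a | ∀ x ∈ T, ∑ i, c x i * a i ∈ Set.Ioo 0 ε} ≤
      (φ * ENNReal.ofReal ε) ^ T.card := by
  classical
  have hmeas : ∀ T : Finset V,
      MeasurableSet {a : ι → ℝ | ∀ x ∈ T, ∑ i, c x i * a i ∈ Set.Ioo 0 ε} := by
    intro T
    have : {a : ι → ℝ | ∀ x ∈ T, ∑ i, c x i * a i ∈ Set.Ioo 0 ε} =
        ⋂ x ∈ T, (fun a : ι → ℝ => ∑ i, c x i * a i) ⁻¹' Set.Ioo 0 ε := by
      ext; simp
    rw [this]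
    exact T.measurableSet_biInter fun x _ => (by fun_prop : Measurable _) measurableSet_Ioo
  induction T using Finset.induction_on_max_value f with
  | empty => simp
  | insert y T hy hmax ih =>
    have ih' := ih (fun x hx => hdiag x (Finset.mem_insert_of_mem hx)) fun x hx z hz =>
      htri x (Finset.mem_insert_of_mem hx) z (Finset.mem_insert_of_mem hz)
    set S : Finset V → Set (ι → ℝ) := fun T => {a | ∀ x ∈ T, ∑ i, c x i * a i ∈ Set.Ioo 0 ε} with hS
    have hupd : ∀ (x : V) (a : ι → ℝ) (t : ℝ), ∑ i, c x i * Function.update a (e y) t i =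
        c x (e y) * t + ∑ i ∈ Finset.univ.erase (e y), c x i * a i := by
      intro x a t
      rw [← Finset.add_sum_erase _ _ (Finset.mem_univ (e y)), Function.update_self]
      congr 1
      refine Finset.sum_congr rfl fun i hi => ?_
      rw [Function.update_of_ne (Finset.ne_of_mem_erase hi)]
    have hfree : ∀ a t, Function.update a (e y) t ∈ S T ↔ a ∈ S T := by
      intro a t
      refine forall₂_congr fun x hx => ?_
      have hzero : c x (e y) = 0 := htri x (Finset.mem_insert_of_mem hx) y
        (Finset.mem_insert_self _ _) (fun h => hy (h ▸ hx)) (hmax x hx)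
      rw [hupd, ← Finset.add_sum_erase _ (fun i => c x i * a i) (Finset.mem_univ (e y)), hzero,
        zero_mul, zero_mul]
    have hle : ∫⁻ a, (S (insert y T)).indicator 1 a ∂Measure.pi ν ≤
        ∫⁻ a, (φ * ENNReal.ofReal ε) * (S T).indicator 1 a ∂Measure.pi ν := by
      refine lintegral_le_of_lmarginal_le {e y} (measurable_one.indicator (hmeas _))
        ((measurable_one.indicator (hmeas _)).const_mul _) ?_
      rw [lmarginal_singleton, lmarginal_singleton]
      intro a
      by_cases ha : a ∈ S T
      · have hr : ∀ t, (S T).indicator (1 : (ι → ℝ) → ℝ≥0∞) (Function.update a (e y) t) = 1 :=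
          fun t => Set.indicator_of_mem ((hfree a t).2 ha) _
        simp only [hr, mul_one, lintegral_const, measure_univ]
        calc ∫⁻ t, (S (insert y T)).indicator (1 : (ι → ℝ) → ℝ≥0∞)
              (Function.update a (e y) t) ∂ν (e y)
            ≤ ∫⁻ t, {t | c y (e y) * t + ∑ i ∈ Finset.univ.erase (e y), c y i * a i
                ∈ Set.Ioo 0 ε}.indicator 1 t ∂ν (e y) := by
              refine lintegral_mono fun t => ?_
              by_cases ht : Function.update a (e y) t ∈ S (insert y T)
              · have := ht y (Finset.mem_insert_self _ _)
                rw [hupd] at this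
                rw [Set.indicator_of_mem ht, Set.indicator_of_mem (by exact this)]
                rfl
              · rw [Set.indicator_of_notMem ht]
                exact zero_le
          _ ≤ ν (e y) {t | c y (e y) * t + ∑ i ∈ Finset.univ.erase (e y), c y i * a i
                ∈ Set.Ioo 0 ε} := lintegral_indicator_one_le _
          _ ≤ _ := measure_affine_mem_Ioo_le (hν _) (hdiag y (Finset.mem_insert_self _ _)) _ _
      · have hl : ∀ t, (S (insert y T)).indicator (1 : (ι → ℝ) → ℝ≥0∞)
            (Function.update a (e y) t) = 0 := fun t =>
          Set.indicator_of_notMem (fun h : _ ∈ S (insert y T) => ha ((hfree a t).1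
            fun x hx => h x (Finset.mem_insert_of_mem hx))) _
        simp only [hl, lintegral_zero]
        exact zero_le
    rw [lintegral_indicator_one (hmeas _), lintegral_const_mul _
      (measurable_one.indicator (hmeas _)), lintegral_indicator_one (hmeas _)] at hle
    rw [Finset.card_insert_of_notMem hy, pow_succ']
    exact hle.trans (mul_le_mul_right ih' _)

/-! ### Slow blocks of moves -/

section SlowBlocks

variable {V : Type*} {k : ℕ}

/-- The players that move, the strategies they move to, and their initial strategies. This
determines the strategies of these players throughout; the strategies of the other players are left
open, so that there are only `(n k ^ 2) ^ ℓ` codes. -/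
def code (ℓ : ℕ) (σ : ℕ → V → Fin k) (u : ℕ → V) : Fin ℓ → V × Fin k × Fin k :=
  fun t => (u t, σ (t + 1) (u t), σ 0 (u t))

theorem eq_of_code_eq {ℓ : ℕ} {σ σ' : ℕ → V → Fin k} {u u' : ℕ → V}
    (hσ : ∀ t < ℓ, ∀ v, v ≠ u t → σ (t + 1) v = σ t v)
    (hσ' : ∀ t < ℓ, ∀ v, v ≠ u' t → σ' (t + 1) v = σ' t v) (h : code ℓ σ u = code ℓ σ' u') :
    (∀ t < ℓ, u t = u' t) ∧ ∀ t ≤ ℓ, ∀ s < ℓ, σ t (u s) = σ' t (u s) := by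
  have hcode : ∀ t < ℓ, u t = u' t ∧ σ (t + 1) (u t) = σ' (t + 1) (u' t) ∧
      σ 0 (u t) = σ' 0 (u' t) := fun t ht => by
    simpa [code] using congrFun h ⟨t, ht⟩
  refine ⟨fun t ht => (hcode t ht).1, fun t => ?_⟩
  induction t with
  | zero => intro _ s hs; rw [(hcode s hs).2.2, (hcode s hs).1]
  | succ t ih =>
    intro ht s hs
    by_cases hst : u s = u t
    · rw [hst, (hcode t ht).2.1, (hcode t ht).1]
    · rw [hσ t ht _ hst, hσ' t ht _ ((hcode t ht).1 ▸ hst), ih (by omega) s hs]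

variable [Fintype V] [DecidableEq V] {G : SimpleGraph V} [DecidableRel G.Adj]

/-- A sequence of `ℓ` improving moves, the move at time `t` being made by `u t`, that increases the
potential by less than `ε` although at least `ℓ / K` players move `k` times or more. -/
structure SlowBlock (A : PayoffIndex G k → ℝ) (ε : ℝ) (K ℓ : ℕ) (σ : ℕ → V → Fin k)
    (u : ℕ → V) : Prop where
  stay : ∀ t < ℓ, ∀ v, v ≠ u t → σ (t + 1) v = σ t v
  improve : ∀ t < ℓ, payoff A (σ t) (u t) < payoff A (σ (t + 1)) (u t)
  slow : potential A (σ ℓ) - potential A (σ 0) < ε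
  heavy : ℓ ≤ K * (frequent u k ℓ).card

theorem SlowBlock.sum_cycleCoeff_mem_Ioo {A : PayoffIndex G k → ℝ} {ε : ℝ} {K ℓ : ℕ}
    {σ : ℕ → V → Fin k} {u : ℕ → V} (h : SlowBlock A ε K ℓ σ u) {a b t : ℕ} {x : V}
    (hat : a ≤ t) (htb : t < b) (hb : b ≤ ℓ) (hx : u t = x) (hcyc : σ a x = σ b x) :
    ∑ e, cycleCoeff σ u ℓ a b x e * A e ∈ Set.Ioo 0 ε := by
  rw [← sum_payoff_sub_eq_sum_cycleCoeff A h.stay (by omega) hb hcyc]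
  have hpos : ∀ s < ℓ, 0 < payoff A (σ (s + 1)) (u s) - payoff A (σ s) (u s) :=
    fun s hs => sub_pos.2 (h.improve s hs)
  have hcongr : ∑ s ∈ Finset.Ico a b with u s = x,
      (payoff A (σ (s + 1)) x - payoff A (σ s) x) = ∑ s ∈ Finset.Ico a b with u s = x,
      (payoff A (σ (s + 1)) (u s) - payoff A (σ s) (u s)) :=
    Finset.sum_congr rfl fun s hs => by rw [(Finset.mem_filter.1 hs).2]
  have hlt : ∀ s ∈ (Finset.Ico a b).filter (fun s => u s = x), s < ℓ := fun s hs => by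
    have := (Finset.mem_Ico.1 (Finset.mem_filter.1 hs).1).2
    omega
  rw [hcongr]
  refine ⟨Finset.sum_pos (fun s hs => hpos s (hlt s hs))
    ⟨t, Finset.mem_filter.2 ⟨Finset.mem_Ico.2 ⟨hat, htb⟩, hx⟩⟩, lt_of_le_of_lt ?_ h.slow⟩
  calc _ ≤ ∑ s ∈ Finset.range ℓ, (payoff A (σ (s + 1)) (u s) - payoff A (σ s) (u s)) :=
        Finset.sum_le_sum_of_subset_of_nonneg (fun s hs => Finset.mem_range.2 (hlt s hs))
          fun s hs _ => (hpos s (Finset.mem_range.1 hs)).le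
    _ = ∑ s ∈ Finset.range ℓ, (potential A (σ (s + 1)) - potential A (σ s)) :=
        Finset.sum_congr rfl fun s hs =>
          (potential_sub_potential A (h.stay s (Finset.mem_range.1 hs))).symm
    _ = _ := Finset.sum_range_sub (fun s => potential A (σ s)) ℓ

/-- Each frequent player `x` has a cycle whose total improvement is a nonzero form in the entries of
the edges at `x`, hence involves an entry of some edge `x (w x)`. That entry occurs in the forms of
`x` and `w x` only, so the forms of the `x` preceding `w x` in a linear order are triangular, and so
are those of the `x` following `w x`; one of these two classes contains half of the players. -/
theorem pi_slowBlock_le {ν : PayoffIndex G k → Measure ℝ} [∀ i, IsProbabilityMeasure (ν i)]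
    {φ : ℝ≥0} (hν : ∀ i s, ν i s ≤ φ * volume s) (ε : ℝ) {K ℓ : ℕ} (hK : 1 ≤ K)
    (p : Fin ℓ → V × Fin k × Fin k) :
    ∃ r : ℕ, ℓ ≤ 2 * K * r ∧
      Measure.pi ν {A | ∃ σ u, SlowBlock A ε K ℓ σ u ∧ code ℓ σ u = p} ≤
        (φ * ENNReal.ofReal ε) ^ r := by
  rcases Set.eq_empty_or_nonempty {A : PayoffIndex G k → ℝ |
      ∃ σ u, SlowBlock A ε K ℓ σ u ∧ code ℓ σ u = p} with hempty | ⟨A₀, σ, u, h, hp⟩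
  · exact ⟨ℓ, by nlinarith, by simp [hempty]⟩
  set T := frequent u k ℓ with hT
  choose! a b t hat htb hb hut hcyc using fun x (hx : x ∈ T) => exists_cycle_of_mem_frequent σ hx
  have hentry : ∀ x ∈ T, ∃ (w : V) (e : PayoffIndex G k), x ≠ w ∧
      (∃ i j : Fin k, e.1 = s((x, i), (w, j))) ∧ cycleCoeff σ u ℓ (a x) (b x) x e ≠ 0 := by
    intro x hx
    have hne := (h.sum_cycleCoeff_mem_Ioo (hat x hx) (htb x hx) (hb x hx) (hut x hx)
      (hcyc x hx)).1.ne'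
    obtain ⟨e, -, he⟩ := Finset.exists_ne_zero_of_sum_ne_zero hne
    obtain ⟨w, hxw, i, j, rfl⟩ := exists_entry_of_cycleCoeff_ne_zero (left_ne_zero_of_mul he)
    exact ⟨w, _, hxw.ne, ⟨i, j, rfl⟩, left_ne_zero_of_mul he⟩
  rcases isEmpty_or_nonempty (PayoffIndex G k) with hI | hI
  · have hT₀ : T = ∅ := Finset.eq_empty_of_forall_notMem fun x hx => by
      obtain ⟨w, e, -⟩ := hentry x hx
      exact hI.elim e
    have := h.heavy
    rw [← hT, hT₀] at this
    exact ⟨0, by simpa using this, by simpa using prob_le_one⟩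
  choose! w e hw he hne using hentry
  have key : ∀ f : V → ℤ, Measure.pi ν {A | ∃ σ u, SlowBlock A ε K ℓ σ u ∧ code ℓ σ u = p} ≤
      (φ * ENNReal.ofReal ε) ^ (T.filter fun x => f x < f (w x)).card := by
    intro f
    refine (measure_mono ?_).trans (pi_forall_mem_Ioo_le hν
      (fun x => cycleCoeff σ u ℓ (a x) (b x) x) e f ε (T.filter fun x => f x < f (w x))
      (fun x hx => one_le_abs_cycleCoeff (hne x (Finset.mem_filter.1 hx).1)) ?_)
    · rintro A ⟨σ', u', h', hp'⟩ x hx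
      have hx := (Finset.mem_filter.1 hx).1
      obtain ⟨hu, hσ⟩ := eq_of_code_eq h.stay h'.stay (hp.trans hp'.symm)
      have htb' := htb x hx
      have hb' := hb x hx
      have hat' := hat x hx
      have hux := hut x hx
      have hcyc' := hcyc x hx
      have hσx : ∀ s ≤ ℓ, σ s x = σ' s x := fun s hs => by
        rw [← hux]
        exact hσ s hs (t x) (by omega)
      rw [hσx _ (by omega), hσx _ (by omega)] at hcyc'
      rw [cycleCoeff_congr hb' hu hσ]
      exact h'.sum_cycleCoeff_mem_Ioo hat' htb' hb' (by rw [← hu _ (by omega), hux]) hcyc'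
    · intro x hx y hy hxy hf
      by_contra hc
      obtain ⟨hyT, hfy⟩ := Finset.mem_filter.1 hy
      obtain ⟨v, hxv, i', j', hev⟩ := exists_entry_of_cycleCoeff_ne_zero hc
      obtain ⟨i, j, hey⟩ := he y hyT
      have hsym : s((y, i), (w y, j)) = s((x, i'), (v, j')) := by
        rw [← hey, hev]
        rfl
      have hmem : (x, i') ∈ s((y, i), (w y, j)) := by
        rw [hsym]
        exact Sym2.mem_mk_left _ _
      rcases Sym2.mem_iff.1 hmem with hm | hm
      · exact hxy (congrArg Prod.fst hm)
      · have hxw : x = w y := congrArg Prod.fst hm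
        rw [hxw] at hf
        omega
  set f : V → ℤ := fun x => (Fintype.equivFin V x : ℕ) with hf
  have hinj : ∀ x y, f x = f y → x = y := fun x y hxy => by
    simpa [hf, Fin.val_inj] using hxy
  have hhalf : T.card ≤ (T.filter fun x => f x < f (w x)).card +
      (T.filter fun x => -f x < -f (w x)).card := by
    rw [← Finset.card_filter_add_card_filter_not (s := T) (fun x => f x < f (w x))]
    refine Nat.add_le_add_left (Finset.card_le_card fun x hx => ?_) _
    obtain ⟨hxT, hx⟩ := Finset.mem_filter.1 hx
    have hfx : f x ≠ f (w x) := fun hfx => hw x hxT (hinj _ _ hfx)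
    exact Finset.mem_filter.2 ⟨hxT, by omega⟩
  have hheavy := h.heavy
  rw [← hT] at hheavy
  rcases le_total (T.filter fun x => f x < f (w x)).card
    (T.filter fun x => -f x < -f (w x)).card with hle | hle
  · exact ⟨_, by nlinarith, key fun x => -f x⟩
  · exact ⟨_, by nlinarith, key f⟩

/-- Union bound over the codes and over the dyadic lengths up to `2 ^ m`. -/
theorem pi_exists_slowBlock_le {ν : PayoffIndex G k → Measure ℝ}
    [∀ i, IsProbabilityMeasure (ν i)] {φ : ℝ≥0} (hν : ∀ i s, ν i s ≤ φ * volume s) {ε : ℝ}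
    {K : ℕ} (hK : 1 ≤ K) (m : ℕ) {x c : ℝ} (hx : 1 ≤ x) (hc : 0 < c)
    (hcode : (Fintype.card V * (k * k) : ℝ) ≤ x ^ (2 : ℝ)) (hm : (m : ℝ) + 1 ≤ x ^ (2 : ℝ))
    (hε : φ * ε ≤ x ^ (-(2 * K * (c + 4)))) :
    Measure.pi ν {A | ∃ j ≤ m, ∃ σ u, SlowBlock A ε K (2 ^ j) σ u} ≤ ENNReal.ofReal (x ^ (-c)) := by
  have hx₀ : 0 < x := by linarith
  have hpow : ∀ {ℓ r : ℕ}, ℓ ≤ 2 * K * r →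
      (φ * ENNReal.ofReal ε) ^ r ≤ ENNReal.ofReal (x ^ (-((c + 4) * ℓ))) := by
    intro ℓ r hr
    have hbase : φ * ENNReal.ofReal ε ≤ ENNReal.ofReal (x ^ (-(2 * K * (c + 4)))) := by
      rw [← ENNReal.ofReal_coe_nnreal, ← ENNReal.ofReal_mul φ.coe_nonneg]
      exact ENNReal.ofReal_le_ofReal hε
    refine (pow_le_pow_left₀ zero_le hbase r).trans ?_
    rw [← ENNReal.ofReal_pow (by positivity), ← Real.rpow_natCast, ← Real.rpow_mul hx₀.le]
    refine ENNReal.ofReal_le_ofReal (Real.rpow_le_rpow_of_exponent_le hx ?_)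
    have hr' : (ℓ : ℝ) ≤ 2 * K * r := by exact_mod_cast hr
    nlinarith
  have hlen : ∀ j, Measure.pi ν {A | ∃ σ u, SlowBlock A ε K (2 ^ j) σ u} ≤
      ENNReal.ofReal (x ^ (-(c + 2))) := by
    intro j
    set ℓ := 2 ^ j with hℓ
    have hℓ₁ : (1 : ℝ) ≤ ℓ := by exact_mod_cast Nat.one_le_two_pow
    have hunion : {A : PayoffIndex G k → ℝ | ∃ σ u, SlowBlock A ε K ℓ σ u} ⊆
        ⋃ p, {A | ∃ σ u, SlowBlock A ε K ℓ σ u ∧ code ℓ σ u = p} := by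
      rintro A ⟨σ, u, h⟩
      exact Set.mem_iUnion.2 ⟨_, σ, u, h, rfl⟩
    calc _ ≤ ∑ p, Measure.pi ν {A | ∃ σ u, SlowBlock A ε K ℓ σ u ∧ code ℓ σ u = p} :=
          (measure_mono hunion).trans (measure_iUnion_fintype_le _ _)
      _ ≤ ∑ p : Fin ℓ → V × Fin k × Fin k, ENNReal.ofReal (x ^ (-((c + 4) * ℓ))) := by
          refine Finset.sum_le_sum fun p _ => ?_
          obtain ⟨r, hr, hle⟩ := pi_slowBlock_le hν ε hK p
          exact hle.trans (hpow hr)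
      _ = ENNReal.ofReal ((Fintype.card V * (k * k) : ℝ) ^ ℓ * x ^ (-((c + 4) * ℓ))) := by
          rw [Finset.sum_const, nsmul_eq_mul, ENNReal.ofReal_mul (by positivity),
            ← ENNReal.ofReal_natCast]
          simp
      _ ≤ ENNReal.ofReal (x ^ (-(c + 2))) := by
          refine ENNReal.ofReal_le_ofReal ?_
          calc _ ≤ (x ^ (2 : ℝ)) ^ ℓ * x ^ (-((c + 4) * ℓ)) := by gcongr
            _ = x ^ (-((c + 2) * ℓ)) := by
                rw [← Real.rpow_natCast, ← Real.rpow_mul hx₀.le, ← Real.rpow_add hx₀]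
                ring_nf
            _ ≤ _ := Real.rpow_le_rpow_of_exponent_le hx (by nlinarith)
  have hunion : {A : PayoffIndex G k → ℝ | ∃ j ≤ m, ∃ σ u, SlowBlock A ε K (2 ^ j) σ u} ⊆
      ⋃ j ∈ Finset.range (m + 1), {A | ∃ σ u, SlowBlock A ε K (2 ^ j) σ u} := by
    rintro A ⟨j, hj, h⟩
    exact Set.mem_iUnion₂.2 ⟨j, Finset.mem_range.2 (by omega), h⟩
  calc _ ≤ ∑ j ∈ Finset.range (m + 1), Measure.pi ν {A | ∃ σ u, SlowBlock A ε K (2 ^ j) σ u} :=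
        (measure_mono hunion).trans (measure_biUnion_finset_le _ _)
    _ ≤ ∑ _j ∈ Finset.range (m + 1), ENNReal.ofReal (x ^ (-(c + 2))) :=
        Finset.sum_le_sum fun j _ => hlen j
    _ = ENNReal.ofReal ((m + 1) * x ^ (-(c + 2))) := by
        rw [Finset.sum_const, nsmul_eq_mul, ENNReal.ofReal_mul (by positivity), Finset.card_range,
          ← ENNReal.ofReal_natCast]
        simp
    _ ≤ _ := by
        refine ENNReal.ofReal_le_ofReal ?_
        calc _ ≤ x ^ (2 : ℝ) * x ^ (-(c + 2)) := by gcongr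
          _ = x ^ (-c) := by rw [← Real.rpow_add hx₀]; ring_nf

end SlowBlocks

/-! ### Executions without slow blocks -/

section Dynamics

variable {V : Type*} [Fintype V] [DecidableEq V] {G : SimpleGraph V} [DecidableRel G.Adj] {k : ℕ}

theorem IsBetterResponse.exists_player {A : PayoffIndex G k → ℝ} {σ σ' : V → Fin k}
    (h : IsBetterResponse A σ σ') :
    ∃ x, (∀ v, v ≠ x → σ' v = σ v) ∧ payoff A σ x < payoff A σ' x := by
  obtain ⟨x, i, rfl, hlt⟩ := h
  exact ⟨x, fun v hv => Function.update_of_ne hv _ _, hlt⟩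

/-- Each window of `2 ^ m` moves contains a dyadic block with many frequent players, which increases
the potential by at least `ε`. -/
theorem exists_isPureNash_of_forall_not_slowBlock [Nonempty V] {A : PayoffIndex G k → ℝ}
    (hA : ∀ e, A e ∈ Set.Icc (-1 : ℝ) 1) {ε : ℝ} (hk : 2 ≤ k) {m : ℕ}
    (hm : 2 * (Fintype.card V * k) ≤ 2 ^ m)
    (hno : ∀ j ≤ m, ∀ σ u, ¬ SlowBlock A ε (2 * k * (m + 1)) (2 ^ j) σ u)
    {σ : ℕ → V → Fin k} (hσ : IsExecution A σ) {M : ℕ}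
    (hM : (Fintype.card V : ℝ) ^ 2 < M * ε) :
    ∃ t ≤ M * 2 ^ m, IsPureNash A (σ t) := by
  by_contra! hcon
  choose! u hstay himp using fun t (ht : t ≤ M * 2 ^ m) =>
    ((hσ t).1 (hcon t ht)).exists_player
  have hmono : ∀ s d, s + d ≤ M * 2 ^ m → potential A (σ s) ≤ potential A (σ (s + d)) := by
    intro s d
    induction d with
    | zero => simp
    | succ d ih =>
      intro hd
      refine (ih (by omega)).trans ?_
      have h₁ := potential_sub_potential A (hstay (s + d) (by omega))
      have h₂ := himp (s + d) (by omega)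
      rw [← add_assoc]
      linarith
  have hwindow : ∀ w ≤ M, potential A (σ 0) + w * ε ≤ potential A (σ (w * 2 ^ m)) := by
    intro w
    induction w with
    | zero => simp
    | succ w ih =>
      intro hw
      have hend : w * 2 ^ m + 2 ^ m ≤ M * 2 ^ m := by
        rw [← Nat.succ_mul]
        exact Nat.mul_le_mul_right _ hw
      obtain ⟨a, j, haj, hheavy⟩ := exists_dyadic_block (fun t => u (w * 2 ^ m + t)) hk hm
      have hpos : 0 < 2 ^ j := by positivity
      have hj : j ≤ m := (Nat.pow_le_pow_iff_right (by norm_num : 1 < 2)).1 (by omega)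
      have hslow : ε ≤ potential A (σ (w * 2 ^ m + a + 2 ^ j)) -
          potential A (σ (w * 2 ^ m + a)) := by
        by_contra! hlt
        refine hno j hj (fun t => σ (w * 2 ^ m + a + t)) (fun t => u (w * 2 ^ m + a + t))
          ⟨fun t ht => hstay (w * 2 ^ m + a + t) (by omega),
            fun t ht => himp (w * 2 ^ m + a + t) (by omega), by simpa using hlt, ?_⟩
        simpa only [add_assoc] using hheavy
      have h₀ := ih (by omega)
      have h₁ := hmono (w * 2 ^ m) a (by omega)
      obtain ⟨d, hd⟩ : ∃ d, 2 ^ m = a + 2 ^ j + d := ⟨2 ^ m - (a + 2 ^ j), by omega⟩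
      have h₂ := hmono (w * 2 ^ m + a + 2 ^ j) d (by omega)
      have heq : (w + 1) * 2 ^ m = w * 2 ^ m + a + 2 ^ j + d := by
        rw [Nat.succ_mul]
        omega
      rw [heq]
      push_cast
      linarith
  have h₁ := hwindow M le_rfl
  have h₂ := abs_le.1 (abs_potential_le hA (σ 0))
  have h₃ := abs_le.1 (abs_potential_le hA (σ (M * 2 ^ m)))
  linarith [h₂.1, h₃.2]

theorem isPureNash_of_isEmpty [IsEmpty (PayoffIndex G k)] (A : PayoffIndex G k → ℝ)
    (σ : V → Fin k) : IsPureNash A σ := by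
  have hpay : ∀ (τ : V → Fin k) x, payoff A τ x = 0 := fun τ x =>
    Finset.sum_eq_zero fun v _ => isEmptyElim (entry v.2 (τ x) (τ v))
  intro x i
  rw [hpay, hpay]

theorem isPureNash_of_le_one (hk : k ≤ 1) (A : PayoffIndex G k → ℝ) (σ : V → Fin k) :
    IsPureNash A σ := by
  have : Subsingleton (Fin k) := Fin.subsingleton_iff_le_one.2 hk
  intro x i
  rw [Subsingleton.elim (Function.update σ x i) σ]

end Dynamics

/-! ### The smoothed model -/

section Smoothed

variable {V Ω : Type*} [MeasurableSpace Ω] {G : SimpleGraph V} {k : ℕ} {μ : Measure Ω}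
  {A : PayoffIndex G k → Ω → ℝ} {φ : ℝ≥0}

theorem IsSmoothed.aemeasurable (h : IsSmoothed μ A φ) (e : PayoffIndex G k) :
    AEMeasurable (A e) μ :=
  (h.hasPDF e).aemeasurable'

theorem IsSmoothed.map_apply_le (h : IsSmoothed μ A φ) (e : PayoffIndex G k) (s : Set ℝ) :
    μ.map (A e) s ≤ φ * volume s := by
  have := h.hasPDF e
  have hle : μ.map (A e) ≤ (φ : ℝ≥0∞) • (volume : Measure ℝ) := by
    rw [map_eq_withDensity_pdf (A e) μ, ← withDensity_const]
    exact withDensity_mono (h.pdf_le e)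
  exact hle s

/-- A probability density on `[-1, 1]` is somewhere at least `1 / 2`. -/
theorem IsSmoothed.one_le_two_mul [IsProbabilityMeasure μ] (h : IsSmoothed μ A φ)
    (e : PayoffIndex G k) : (1 : ℝ) ≤ 2 * φ := by
  have h₁ : μ (A e ⁻¹' Set.Icc (-1) 1) = 1 := by
    rw [← prob_compl_eq_zero_iff₀ ((h.aemeasurable e).nullMeasurable measurableSet_Icc)]
    exact h.mem_Icc e
  have h₂ := (Measure.le_map_apply (h.aemeasurable e) (Set.Icc (-1) 1)).trans
    (h.map_apply_le e (Set.Icc (-1) 1))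
  rw [h₁, Real.volume_Icc, ← ENNReal.ofReal_coe_nnreal, ← ENNReal.ofReal_mul φ.coe_nonneg,
    ENNReal.one_le_ofReal] at h₂
  linarith

/-- The payoff vector has the product of the laws of the entries as its law. -/
theorem IsSmoothed.measure_preimage_le [Fintype V] [IsProbabilityMeasure μ] (h : IsSmoothed μ A φ)
    (S : Set (PayoffIndex G k → ℝ)) :
    μ {ω | (fun e => A e ω) ∈ S} ≤ Measure.pi (fun e => μ.map (A e)) S := by
  rw [← (iIndepFun_iff_map_fun_eq_pi_map h.aemeasurable).1 h.indep]
  exact Measure.le_map_apply (aemeasurable_pi_lambda _ h.aemeasurable) S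

end Smoothed

/-! ### Numerical estimates and conclusion -/

theorem exists_window {N : ℕ} (hN : 4 ≤ N) : ∃ m : ℕ, 2 * N ≤ 2 ^ m ∧ (2 : ℝ) ^ m ≤ 4 * N ∧
    (m : ℝ) + 1 ≤ (N : ℝ) ^ (2 : ℝ) ∧ (m : ℝ) + 1 ≤ 5 * Real.log N := by
  have hpred := Nat.pow_pred_clog_lt_self (b := 2) (by norm_num) (x := 2 * N) (by omega)
  have hclog : 0 < Nat.clog 2 (2 * N) := Nat.clog_pos (by norm_num) (by omega)
  refine ⟨Nat.clog 2 (2 * N), Nat.le_pow_clog (by norm_num) _, ?_⟩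
  obtain ⟨p, hp⟩ : ∃ p, Nat.clog 2 (2 * N) = p + 1 := ⟨Nat.clog 2 (2 * N) - 1, by omega⟩
  rw [hp] at hpred ⊢
  simp only [Nat.pred_succ] at hpred
  have hpow : 2 ^ (p + 1) ≤ 4 * N := by rw [pow_succ]; omega
  have hpow' : (2 : ℝ) ^ (p + 1) ≤ 4 * N := by exact_mod_cast hpow
  have hN' : (4 : ℝ) ≤ N := by exact_mod_cast hN
  have hlog4 : Real.log 4 = 2 * Real.log 2 := by
    rw [show (4 : ℝ) = 2 ^ 2 by norm_num, Real.log_pow]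
    norm_num
  have hlog2 := Real.log_two_gt_d9
  have hlogN : Real.log 4 ≤ Real.log N := Real.log_le_log (by norm_num) hN'
  refine ⟨hpow', ?_, ?_⟩
  · have hlt : p + 1 + 1 ≤ 2 ^ (p + 1) := Nat.lt_two_pow_self
    have hlt' : (p : ℝ) + 1 + 1 ≤ 2 ^ (p + 1) := by exact_mod_cast hlt
    rw [Real.rpow_two]
    push_cast
    nlinarith
  · have h := Real.log_le_log (by positivity) hpow'
    rw [Real.log_pow, Real.log_mul (by norm_num) (by positivity)] at h
    push_cast at h ⊢
    nlinarith

/-- The number of moves in `M` windows, for the least `M` with `n ^ 2 < M ε`, where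
`ε = x ^ (-q) / φ` and each window has at most `4 x` moves. -/
theorem exists_number_of_windows {φ n x q L : ℝ} (hφ : 1 ≤ 2 * φ) (hn : 0 ≤ n) (hx : 4 ≤ x)
    (hnx : n ≤ x) (hq : 0 ≤ q) (hL : L ≤ 4 * x) (hL₀ : 0 ≤ L) :
    ∃ M : ℕ, n ^ 2 < M * (x ^ (-q) / φ) ∧ M * L ≤ φ * x ^ (q + 5) := by
  have hx₀ : 0 < x := by linarith
  have hφ₀ : 0 < φ := by linarith
  have hxq : 1 ≤ x ^ q := Real.one_le_rpow (by linarith) hq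
  refine ⟨⌊n ^ 2 * (φ * x ^ q)⌋₊ + 1, ?_, ?_⟩
  · have hlt := Nat.lt_floor_add_one (n ^ 2 * (φ * x ^ q))
    rw [Real.rpow_neg hx₀.le, ← one_div, div_div, mul_one_div, lt_div_iff₀ (by positivity),
      mul_comm (x ^ q)]
    exact_mod_cast hlt
  · have hle := Nat.floor_le (a := n ^ 2 * (φ * x ^ q)) (by positivity)
    have hn2 : n ^ 2 ≤ x ^ 2 := by gcongr
    have hM : ((⌊n ^ 2 * (φ * x ^ q)⌋₊ + 1 : ℕ) : ℝ) ≤ φ * x ^ q * (x ^ 2 + 2) := by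
      push_cast
      have h₁ : n ^ 2 * (φ * x ^ q) ≤ x ^ 2 * (φ * x ^ q) := by gcongr
      nlinarith
    have hpoly : (x ^ 2 + 2) * (4 * x) ≤ x ^ 5 := by nlinarith [pow_pos hx₀ 3, pow_pos hx₀ 4]
    calc _ ≤ φ * x ^ q * (x ^ 2 + 2) * (4 * x) := by gcongr
      _ = φ * x ^ q * ((x ^ 2 + 2) * (4 * x)) := by ring
      _ ≤ φ * x ^ q * x ^ 5 := by gcongr
      _ = φ * x ^ (q + 5) := by
        rw [Real.rpow_add hx₀, mul_assoc]
        norm_cast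

end NetCoord

theorem mainTheorem2 :
    ∀ c : ℝ, 0 < c → ∃ C : ℝ, 0 < C ∧
      ∀ (V : Type*) [Fintype V] [DecidableEq V] [Nonempty V]
        (G : SimpleGraph V) [DecidableRel G.Adj] (k : ℕ), 1 ≤ k →
      ∀ (φ : ℝ≥0) (Ω : Type*) [MeasurableSpace Ω] (μ : Measure Ω) [IsProbabilityMeasure μ]
        (A : NetCoord.PayoffIndex G k → Ω → ℝ), NetCoord.IsSmoothed μ A φ →
        1 - 1 / ((Fintype.card V * k : ℕ) : ℝ) ^ c ≤
          μ.real {ω | ∀ σ : ℕ → V → Fin k, NetCoord.IsExecution (fun e => A e ω) σ →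
            ∃ t : ℕ,
              (t : ℝ) ≤ φ * ((Fintype.card V * k : ℕ) : ℝ) ^
                (C * k * Real.log ((Fintype.card V * k : ℕ) : ℝ)) ∧
              NetCoord.IsPureNash (fun e => A e ω) (σ t)} := by
  intro c hc
  refine ⟨20 * (c + 4) + 5, by positivity, ?_⟩
  intro V _ _ _ G _ k hk₁ φ Ω _ μ _ A hA
  set N := Fintype.card V * k with hN
  set good := {ω | ∀ σ : ℕ → V → Fin k, NetCoord.IsExecution (fun e => A e ω) σ →
    ∃ t : ℕ, (t : ℝ) ≤ φ * (N : ℝ) ^ ((20 * (c + 4) + 5) * k * Real.log N) ∧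
      NetCoord.IsPureNash (fun e => A e ω) (σ t)} with hgood
  have htrivial : (∀ ω (σ : V → Fin k), NetCoord.IsPureNash (fun e => A e ω) σ) →
      1 - 1 / (N : ℝ) ^ c ≤ μ.real good := by
    intro hnash
    have : good = Set.univ := Set.eq_univ_of_forall fun ω σ _ =>
      ⟨0, by rw [Nat.cast_zero]; positivity, hnash ω _⟩
    rw [this, probReal_univ]
    exact sub_le_self _ (by positivity)
  rcases isEmpty_or_nonempty (NetCoord.PayoffIndex G k) with hI | ⟨⟨e⟩⟩
  · exact htrivial fun ω σ => NetCoord.isPureNash_of_isEmpty _ σ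
  rcases Nat.lt_or_ge k 2 with hk | hk
  · exact htrivial fun ω σ => NetCoord.isPureNash_of_le_one (by omega) _ σ
  have hcard : 2 ≤ Fintype.card V := by
    obtain ⟨e, he⟩ := e
    induction e using Sym2.ind with
    | _ p q => exact Fintype.one_lt_card_iff.2 ⟨p.1, q.1, (show G.Adj p.1 q.1 from he).ne⟩
  have hN4 : 4 ≤ N := Nat.mul_le_mul hcard hk
  obtain ⟨m, hm, hmN, hm2, hmlog⟩ := NetCoord.exists_window hN4
  have hφ := hA.one_le_two_mul e
  have hφ₀ : (0 : ℝ) < φ := by linarith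
  have hN' : (4 : ℝ) ≤ N := by exact_mod_cast hN4
  set K := 2 * k * (m + 1) with hK
  set q : ℝ := 2 * K * (c + 4) with hq
  have hcard' : (Fintype.card V : ℝ) ≤ N := by
    exact_mod_cast Nat.le_mul_of_pos_right _ (by omega)
  obtain ⟨M, hM, hML⟩ := NetCoord.exists_number_of_windows hφ (Nat.cast_nonneg (Fintype.card V))
    hN' hcard' (by positivity : 0 ≤ q) hmN (by positivity)
  set ε : ℝ := (N : ℝ) ^ (-q) / φ with hε
  have hexp : q + 5 ≤ (20 * (c + 4) + 5) * k * Real.log N := by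
    have hk' : (1 : ℝ) ≤ k := by exact_mod_cast hk₁
    have hlog : (1 : ℝ) ≤ k * Real.log N := by
      have : (1 : ℝ) ≤ Real.log N := by
        rw [Real.le_log_iff_exp_le (by linarith)]
        linarith [Real.exp_one_lt_d9]
      nlinarith
    have h₁ : k * ((m : ℝ) + 1) ≤ k * (5 * Real.log N) := by gcongr
    have hqK : q = 4 * (c + 4) * (k * ((m : ℝ) + 1)) := by
      rw [hq, hK]
      push_cast
      ring
    rw [hqK]
    nlinarith
  have hsteps : ∀ t ≤ M * 2 ^ m,
      (t : ℝ) ≤ φ * (N : ℝ) ^ ((20 * (c + 4) + 5) * k * Real.log N) := by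
    intro t ht
    calc (t : ℝ) ≤ M * 2 ^ m := by exact_mod_cast ht
      _ ≤ φ * (N : ℝ) ^ (q + 5) := hML
      _ ≤ _ := by
        gcongr
        linarith
  have hprob : ∀ e, IsProbabilityMeasure (μ.map (A e)) := fun e =>
    Measure.isProbabilityMeasure_map (hA.aemeasurable e)
  have hslow := (hA.measure_preimage_le _).trans
    (NetCoord.pi_exists_slowBlock_le (G := G) hA.map_apply_le (ε := ε) (K := K)
      (Nat.mul_pos (by omega) (by omega)) m
      (by linarith : (1 : ℝ) ≤ N) hc
      (by
        rw [Real.rpow_two]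
        have : Fintype.card V * (k * k) ≤ N ^ 2 := by
          rw [hN]
          nlinarith [Nat.mul_le_mul_right (Fintype.card V * (k * k)) (by omega :
            1 ≤ Fintype.card V)]
        exact_mod_cast this)
      hm2 (by rw [hε, mul_div_cancel₀ _ hφ₀.ne']))
  have hrange : μ {ω | ¬ ∀ e, A e ω ∈ Set.Icc (-1 : ℝ) 1} = 0 := ae_all_iff.2 hA.mem_Icc
  have hcompl : μ goodᶜ ≤ ENNReal.ofReal ((N : ℝ) ^ (-c)) := by
    refine (measure_mono fun ω hω => ?_).trans ((measure_union_le _ _).trans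
      ((add_le_add hslow hrange.le).trans_eq (add_zero _)))
    by_contra hnot
    rw [Set.mem_union, not_or] at hnot
    obtain ⟨hnot₁, hnot₂⟩ := hnot
    refine hω fun σ hσ => ?_
    obtain ⟨t, ht, hnash⟩ := NetCoord.exists_isPureNash_of_forall_not_slowBlock
      (not_not.1 hnot₂) hk hm (fun j hj σ u h => hnot₁ ⟨j, hj, σ, u, h⟩) hσ hM
    exact ⟨t, hsteps t ht, hnash⟩
  have hcompl' : μ.real goodᶜ ≤ 1 / (N : ℝ) ^ c := by
    rw [one_div, ← Real.rpow_neg (by linarith)]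
    exact ENNReal.toReal_le_of_le_ofReal (by positivity) hcompl
  -- `good` need not be measurable, so subadditivity replaces the complement rule.
  have hone : 1 ≤ μ.real good + μ.real goodᶜ := by
    have := measureReal_union_le (μ := μ) good goodᶜ
    rwa [Set.union_compl_self, probReal_univ] at this
  linarith
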